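/- \textbf{Lemma (FCFS within each class is optimal).} Consider a single-server preemptive queue, empty at time $0$, with $k$ job classes. Class $i$ jobs arrive as a Poisson process of rate $\lambda_i>0$ and have $\mathrm{Exp}(\mu_i)$ sizes, $\mu_i>0$. A class $i$ job of age $t$ incurs holding cost at rate $c_i(t)$, where $c_i:[0,\infty)\to[0,\infty)$ is non-decreasing. A sample path consists of two sequences of positive numbers for each class $i$: the inter-arrival times of class $i$, i.i.d. $\mathrm{Exp}(\lambda_i)$, and the settings of a class $i$ service timer, i.i.d. $\mathrm{Exp}(\mu_i)$, all sequences being independent; only paths on which the arrival times of each class tend to infinity are considered (this has probability one). The class $i$ timer runs exactly while the server works on class $i$ and is paused otherwise; whenever it goes off, the class $i$ job then in service completes and leaves, and the timer is reset to its next setting. A policy $\pi$ (possibly idling, possibly using a random seed independent of the sample path) chooses, measurably, at each time $t$ at most one job to work on, among the jobs that arrived before $t$ and have not completed before $t$, as a function of the seed and of the arrivals and timer events before $t$, in such a way that whenever the class $i$ timer goes off a class $i$ job is in service. Let $c^\pi_{total}(s)$ be the sum of the instantaneous holding costs of all jobs in the system at time $s$. Let $\pi$ be any policy. Then there is a policy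 $\pi_{FCFS}$ which, at every moment and on every sample path (and for every seed), works on the same class as $\pi$ (idling when $\pi$ idles) and serves the jobs of each class in order of arrival. For every such $\pi_{FCFS}$: \begin{enumerate} \item on every sample path, for every seed and every $t$, $\int_0^t c^{\pi_{FCFS}}_{total}(s)\,ds\le\int_0^t c^{\pi}_{total}(s)\,ds$; \item consequently, on every sample path and for every seed, $\limsup_{t\to\infty}\frac1t\int_0^t c^{\pi_{FCFS}}_{total}(s)\,ds\le\limsup_{t\to\infty}\frac1t\int_0^t c^{\pi}_{total}(s)\,ds$, and also $\limsup_{t\to\infty}\frac1t\mathbb E\int_0^t c^{\pi_{FCFS}}_{total}(s)\,ds\le\limsup_{t\to\infty}\frac1t\mathbb E\int_0^t c^{\pi}_{total}(s)\,ds$ (values in $[0,\infty]$); \item hence, if $\pi$ is optimal among all policies, then $\pi_{FCFS}$, which serves each class FCFS, is optimal too. This holds both when a policy is called optimal if it minimizes the long-run average of the mean holding cost (the last $\limsup$ above), and when it is called optimal if its pathwise long-run average holding cost is almost surely at most that of any other policy. \end{enumerate} -/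

import Mathlib

open MeasureTheory ProbabilityTheory Filter Set
open scoped ENNReal

namespace TVHC

noncomputable section

/-- A job `(i, n)` is the `n`-th arriving job (counted from `0`) of class `i`. -/
abbrev Job (k : ℕ) := Fin k × ℕ

/-- Raw sample paths: `(ω i n).1` is the `n`-th inter-arrival time of class `i` and `(ω i n).2` is
the `n`-th setting of the service timer of class `i`. A path is regular if all these numbers are
positive and the arrival times of each class tend to infinity. -/
def Regular {k : ℕ} (ω : Fin k → ℕ → ℝ × ℝ) : Prop :=
  ∀ i, (∀ n, 0 < (ω i n).1 ∧ 0 < (ω i n).2) ∧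
    Tendsto (fun n : ℕ => ∑ m ∈ Finset.range (n + 1), (ω i m).1) atTop atTop

/-- Sample paths: two sequences of positive numbers for each class (inter-arrival times and
service timers), with finitely many arrivals in every bounded time interval. -/
abbrev SamplePath (k : ℕ) := {ω : Fin k → ℕ → ℝ × ℝ // Regular ω}

/-- The law of the raw sequences: all entries are independent, inter-arrival times of class `i` are
`Exp(lam i)` and service timers of class `i` are `Exp(mu i)`. -/
def rawLaw {k : ℕ} (lam mu : Fin k → ℝ) : Measure (Fin k → ℕ → ℝ × ℝ) :=
  Measure.pi fun i => Measure.infinitePi fun _ : ℕ =>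
    (expMeasure (lam i)).prod (expMeasure (mu i))

/-- The law of the sample path. (Raw sequences are almost surely regular, see
`isProbabilityMeasure_law`.) -/
def law {k : ℕ} (lam mu : Fin k → ℝ) : Measure (SamplePath k) :=
  (rawLaw lam mu).comap Subtype.val

/-- Arrival time of a job. -/
def arrival {k : ℕ} (ω : SamplePath k) (j : Job k) : ℝ :=
  ∑ m ∈ Finset.range (j.2 + 1), (ω.1 j.1 m).1

/-- A schedule gives for every time `t` the job on which the server works at time `t` (if any),
as decided just before `t`. This is the time spent on class `i` during `(0, t]`. -/
def workTime {k : ℕ} (σ : ℝ → Option (Job k)) (i : Fin k) (t : ℝ) : ℝ≥0∞ :=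
  volume {s | s ∈ Ioc 0 t ∧ (σ s).map Prod.fst = some i}

/-- The class-`i` timer, which runs only while class `i` is being served, goes off for the `n`-th
time (counted from `0`) at time `d`: `d` is the first time at which the time spent on class `i`
reaches the sum of the first `n + 1` timer settings. -/
def TimerFires {k : ℕ} (ω : SamplePath k) (σ : ℝ → Option (Job k)) (i : Fin k) (n : ℕ)
    (d : ℝ) : Prop :=
  IsLeast {t : ℝ | ENNReal.ofReal (∑ m ∈ Finset.range (n + 1), (ω.1 i m).2) ≤ workTime σ i t} d

/-- Job `j` completes at time `d`: the timer of its class goes off while `j` is in service. -/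
def Completes {k : ℕ} (ω : SamplePath k) (σ : ℝ → Option (Job k)) (j : Job k) (d : ℝ) : Prop :=
  σ d = some j ∧ ∃ n, TimerFires ω σ j.1 n d

/-- Job `j` is in the system at time `t` (just before `t`): it arrived before `t` and has not
completed before `t`. -/
def Present {k : ℕ} (ω : SamplePath k) (σ : ℝ → Option (Job k)) (j : Job k) (t : ℝ) : Prop :=
  arrival ω j < t ∧ ∀ d < t, ¬ Completes ω σ j d

section Policies

variable {k : ℕ} {U : Type*} [MeasurableSpace U]

/-- A scheduling policy (preemptive, possibly idling, possibly randomized through a seed `u : U`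
that is independent of the sample path): `π u ω t` is the job in service at time `t`. -/
structure IsPolicy (π : U → SamplePath k → ℝ → Option (Job k)) : Prop where
  /-- The decisions depend measurably on seed, sample path and time. -/
  measurable : ∀ j, MeasurableSet {p : U × SamplePath k × ℝ | π p.1 p.2.1 p.2.2 = some j}
  /-- Only jobs that are in the system are served. -/
  present : ∀ u ω t j, π u ω t = some j → Present ω (π u ω) j t
  /-- Whenever the timer of class `i` goes off, a class-`i` job is in service (it completes). -/
  inService : ∀ u ω i n d, TimerFires ω (π u ω) i n d → ∃ m, π u ω d = some (i, m)
  /-- The decision at time `t` depends only on the seed and on the arrivals and the timer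
  events (hence the completions) before time `t`. -/
  nonanticipating : ∀ u ω ω' t,
    (∀ j, ∀ s < t, arrival ω j = s ↔ arrival ω' j = s) →
    (∀ i n, ∀ s < t, TimerFires ω (π u ω) i n s ↔ TimerFires ω' (π u ω') i n s) →
    π u ω t = π u ω' t

/-- Within each class jobs are served in order of arrival: a job is served only when no
earlier job of its class is in the system. -/
def ServesFCFS (π : U → SamplePath k → ℝ → Option (Job k)) : Prop :=
  ∀ u ω t i n, π u ω t = some (i, n) → ∀ m < n, ¬ Present ω (π u ω) (i, m) t

/-- At every moment the two policies work on the same class (or both idle). -/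
def SameClass (π π' : U → SamplePath k → ℝ → Option (Job k)) : Prop :=
  ∀ u ω t, (π u ω t).map Prod.fst = (π' u ω t).map Prod.fst

/-- Sum of the instantaneous holding costs of all jobs in the system at time `s`. -/
def totalCost (c : Fin k → ℝ → ℝ) (ω : SamplePath k) (σ : ℝ → Option (Job k)) (s : ℝ) : ℝ≥0∞ :=
  ∑' j : {j : Job k // Present ω σ j s}, ENNReal.ofReal (c j.1.1 (s - arrival ω j.1))

/-- Holding cost incurred up to time `t`. -/
def costUpTo (c : Fin k → ℝ → ℝ) (ω : SamplePath k) (σ : ℝ → Option (Job k)) (t : ℝ) : ℝ≥0∞ :=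
  ∫⁻ s in Ioc 0 t, totalCost c ω σ s

/-- Long-run time-average holding cost on a sample path. -/
def pathCost (c : Fin k → ℝ → ℝ) (ω : SamplePath k) (σ : ℝ → Option (Job k)) : ℝ≥0∞ :=
  limsup (fun t : ℝ => costUpTo c ω σ t / ENNReal.ofReal t) atTop

/-- Long-run time-average of the mean holding cost of a policy. -/
def meanCost (ν : Measure U) (lam mu : Fin k → ℝ) (c : Fin k → ℝ → ℝ)
    (π : U → SamplePath k → ℝ → Option (Job k)) : ℝ≥0∞ :=
  limsup (fun t : ℝ => (∫⁻ u, ∫⁻ ω, costUpTo c ω (π u ω) t ∂(law lam mu) ∂ν) / ENNReal.ofReal t)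
    atTop

/-- Optimality for the long-run mean holding cost, among all policies. -/
def IsMeanOptimal (ν : Measure U) (lam mu : Fin k → ℝ) (c : Fin k → ℝ → ℝ)
    (π : U → SamplePath k → ℝ → Option (Job k)) : Prop :=
  IsPolicy π ∧ ∀ π', IsPolicy π' → meanCost ν lam mu c π ≤ meanCost ν lam mu c π'

/-- Almost sure optimality for the pathwise long-run holding cost, among all policies. -/
def IsPathOptimal (ν : Measure U) (lam mu : Fin k → ℝ) (c : Fin k → ℝ → ℝ)
    (π : U → SamplePath k → ℝ → Option (Job k)) : Prop :=
  IsPolicy π ∧ ∀ π', IsPolicy π' → ∀ᵐ p ∂(ν.prod (law lam mu)),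
    pathCost c p.2 (π p.1 p.2) ≤ pathCost c p.2 (π' p.1 p.2)

end Policies

theorem measurableSet_regular {k : ℕ} :
    MeasurableSet {ω : Fin k → ℕ → ℝ × ℝ | Regular ω} := by
  have hT : ∀ i : Fin k, MeasurableSet {ω : Fin k → ℕ → ℝ × ℝ |
      Tendsto (fun n : ℕ => ∑ m ∈ Finset.range (n + 1), (ω i m).1) atTop atTop} := by
    intro i
    have : {ω : Fin k → ℕ → ℝ × ℝ |
        Tendsto (fun n : ℕ => ∑ m ∈ Finset.range (n + 1), (ω i m).1) atTop atTop} =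
        ⋂ B : ℕ, ⋃ N : ℕ, ⋂ n : ℕ, ⋂ _ : N ≤ n,
          {ω | (B : ℝ) ≤ ∑ m ∈ Finset.range (n + 1), (ω i m).1} := by
      ext ω
      simp only [mem_ofPred_eq, mem_iInter, mem_iUnion]
      rw [tendsto_atTop]
      constructor
      · intro h B
        exact eventually_atTop.1 (h B)
      · intro h b
        obtain ⟨B, hB⟩ := exists_nat_ge b
        obtain ⟨N, hN⟩ := h B
        exact eventually_atTop.2 ⟨N, fun n hn => hB.trans (hN n hn)⟩
    rw [this]
    refine MeasurableSet.iInter fun B => MeasurableSet.iUnion fun N => MeasurableSet.iInter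
      fun n => MeasurableSet.iInter fun _ => measurableSet_le measurable_const ?_
    fun_prop
  have : {ω : Fin k → ℕ → ℝ × ℝ | Regular ω} =
      ⋂ i, ((⋂ n, ({ω | 0 < (ω i n).1} ∩ {ω | 0 < (ω i n).2})) ∩ {ω : Fin k → ℕ → ℝ × ℝ |
      Tendsto (fun n : ℕ => ∑ m ∈ Finset.range (n + 1), (ω i m).1) atTop atTop}) := by
    ext ω
    simp [Regular]
  rw [this]
  refine MeasurableSet.iInter fun i => (MeasurableSet.iInter fun n => ?_).inter (hT i)
  exact (measurableSet_lt measurable_const (by fun_prop)).inter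
    (measurableSet_lt measurable_const (by fun_prop))

theorem expMeasure_Iic {r : ℝ} (hr : 0 < r) (x : ℝ) :
    expMeasure r (Iic x) = ENNReal.ofReal (if 0 ≤ x then 1 - Real.exp (-(r * x)) else 0) := by
  rw [← lintegral_exponentialPDF_eq_antiDeriv hr x, expMeasure, gammaMeasure,
    withDensity_apply _ measurableSet_Iic]
  rfl

theorem ae_pos_expMeasure {r : ℝ} (hr : 0 < r) : ∀ᵐ x ∂(expMeasure r), 0 < x := by
  rw [ae_iff]
  have : {a : ℝ | ¬ 0 < a} = Iic 0 := by ext; simp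
  rw [this, expMeasure_Iic hr]
  simp

theorem ae_tendsto_sum {P : ℕ → Measure (ℝ × ℝ)} [∀ n, IsProbabilityMeasure (P n)] {q : ℝ≥0∞}
    (hq : q ≠ 0) (hP : ∀ n, P n {x | 1 < x.1} = q)
    (hpos : ∀ n, ∀ᵐ x ∂(P n), 0 < x.1) :
    ∀ᵐ x ∂(Measure.infinitePi P),
      Tendsto (fun n : ℕ => ∑ m ∈ Finset.range (n + 1), (x m).1) atTop atTop := by
  have hm : MeasurableSet {x : ℝ × ℝ | 1 < x.1} := measurableSet_lt measurable_const measurable_fst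
  have hmp := fun n => measurePreserving_eval_infinitePi P n
  have hS : ∀ n, MeasurableSet ((fun x : ℕ → ℝ × ℝ => x n) ⁻¹' {x | 1 < x.1}) := fun n =>
    hm.preimage (measurable_pi_apply n)
  have hind : iIndepSet (fun n => (fun x : ℕ → ℝ × ℝ => x n) ⁻¹' {x | 1 < x.1})
      (Measure.infinitePi P) := by
    rw [iIndepSet_iff_meas_biInter hS]
    intro s
    exact (iIndepFun_infinitePi (P := P) (X := fun _ x => x)
      (fun _ => measurable_id)).measure_inter_preimage_eq_mul s (fun _ _ => hm)
  have hone := measure_limsup_eq_one hS hind (by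
    have : ∀ n, Measure.infinitePi P ((fun x : ℕ → ℝ × ℝ => x n) ⁻¹' {x | 1 < x.1}) = q := by
      intro n
      rw [(hmp n).measure_preimage hm.nullMeasurableSet, hP]
    simp_rw [this]
    exact ENNReal.tsum_const_eq_top_of_ne_zero hq)
  have hae := (mem_ae_iff_prob_eq_one (MeasurableSet.measurableSet_limsup hS)).2 hone
  have hpos' : ∀ᵐ x ∂(Measure.infinitePi P), ∀ n, 0 < (x n).1 :=
    ae_all_iff.2 fun n => (hmp n).quasiMeasurePreserving.ae (hpos n)
  filter_upwards [hae, hpos'] with x hx hx0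
  rw [limsup_eq_iInf_iSup_of_nat] at hx
  simp only [iSup_eq_iUnion, iInf_eq_iInter, mem_iInter, mem_iUnion] at hx
  have hmono : Monotone fun n : ℕ => ∑ m ∈ Finset.range (n + 1), (x m).1 :=
    monotone_nat_of_le_succ fun n => by
      rw [Finset.sum_range_succ _ (n + 1)]; linarith [hx0 (n + 1)]
  have key : ∀ B : ℕ, ∃ n : ℕ, (B : ℝ) ≤ ∑ m ∈ Finset.range (n + 1), (x m).1 := by
    intro B
    induction B with
    | zero => exact ⟨0, by simpa using (hx0 0).le⟩
    | succ B ih =>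
      obtain ⟨n, hn⟩ := ih
      obtain ⟨p, hp, h1⟩ := hx (n + 1)
      refine ⟨p, ?_⟩
      have h2 : ∑ m ∈ Finset.range (n + 1), (x m).1 ≤ ∑ m ∈ Finset.range p, (x m).1 :=
        Finset.sum_le_sum_of_subset_of_nonneg (by simpa using hp) (fun m _ _ => (hx0 m).le)
      have h3 : 1 < (x p).1 := h1
      rw [Finset.sum_range_succ]
      push_cast
      linarith
  refine tendsto_atTop_atTop_of_monotone hmono fun b => ?_
  obtain ⟨B, hB⟩ := exists_nat_ge b
  obtain ⟨n, hn⟩ := key B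
  exact ⟨n, hB.trans hn⟩

/-- For positive rates the restriction to regular sample paths loses no mass. -/
theorem isProbabilityMeasure_law {k : ℕ} {lam mu : Fin k → ℝ} (hlam : ∀ i, 0 < lam i)
    (hmu : ∀ i, 0 < mu i) : IsProbabilityMeasure (law lam mu) := by
  have := fun i => isProbabilityMeasure_expMeasure (hlam i)
  have := fun i => isProbabilityMeasure_expMeasure (hmu i)
  have : IsProbabilityMeasure (rawLaw lam mu) := by unfold rawLaw; infer_instance
  have hreg : ∀ᵐ ω ∂(rawLaw lam mu), Regular ω := by
    refine ae_all_iff.2 fun i => ?_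
    have hev : MeasurePreserving (fun ω : Fin k → ℕ → ℝ × ℝ => ω i) (rawLaw lam mu)
        (Measure.infinitePi fun _ : ℕ => (expMeasure (lam i)).prod (expMeasure (mu i))) :=
      measurePreserving_eval _ i
    have h1 : ∀ᵐ x ∂((expMeasure (lam i)).prod (expMeasure (mu i))), 0 < x.1 :=
      Measure.quasiMeasurePreserving_fst.ae (ae_pos_expMeasure (hlam i))
    have h2 : ∀ᵐ x ∂((expMeasure (lam i)).prod (expMeasure (mu i))), 0 < x.2 :=
      Measure.quasiMeasurePreserving_snd.ae (ae_pos_expMeasure (hmu i))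
    refine hev.quasiMeasurePreserving.ae (p := fun x : ℕ → ℝ × ℝ =>
      (∀ n, 0 < (x n).1 ∧ 0 < (x n).2) ∧
        Tendsto (fun n : ℕ => ∑ m ∈ Finset.range (n + 1), (x m).1) atTop atTop) ?_
    refine (ae_all_iff.2 fun n => ?_).and ?_
    · exact (measurePreserving_eval_infinitePi (fun _ : ℕ =>
        (expMeasure (lam i)).prod (expMeasure (mu i))) n).quasiMeasurePreserving.ae (h1.and h2)
    · refine ae_tendsto_sum (q := expMeasure (lam i) (Ioi 1)) ?_ (fun n => ?_) (fun _ => h1)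
      · have : Ioi (1 : ℝ) = (Iic 1)ᶜ := by simp
        rw [this, prob_compl_eq_one_sub measurableSet_Iic, expMeasure_Iic (hlam i)]
        refine (tsub_pos_iff_lt.2 ?_).ne'
        rw [← ENNReal.ofReal_one, ENNReal.ofReal_lt_ofReal_iff one_pos, if_pos zero_le_one]
        linarith [Real.exp_pos (-(lam i * 1))]
      · have : {x : ℝ × ℝ | 1 < x.1} = Ioi 1 ×ˢ univ := by ext; simp
        rw [this, Measure.prod_prod, measure_univ, mul_one]
  refine (MeasurableEmbedding.subtype_coe measurableSet_regular).isProbabilityMeasure_comap ?_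
  simpa using hreg

end

end TVHC

namespace TVHC

section Schedules

variable {k : ℕ} {ω : SamplePath k} {σ σ' : ℝ → Option (Job k)} {i : Fin k}

/-! The timer of a class sees a schedule only through the times at which that class is served, so
two policies that always work on the same class have the same timer events. Each timer event
completes exactly one job, so at every moment both policies have completed the same number `N` of
jobs of each class (`Admissible.ncard_completed`), out of the same number `A` of arrivals. Under
FCFS the completed jobs are the `N` oldest (`Admissible.completed_eq_of_fcfs`), so those left are
the `A - N` youngest. As cost does not decrease with age, no other set of `A - N` arrived jobs is
cheaper (`sum_Ico_le_sum_range_sdiff`). The cost rates are thus ordered at every moment on every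
path, and integrals, means, limsups and optimality follow by monotonicity.

For existence, `fcfsPolicy` keeps the class chosen by `π` and serves the job whose index is the
number of past timer events of that class. Since that number is read off `π` itself, no recursion in
time is needed, and the policy inherits measurability and nonanticipation from `π`. -/

theorem arrival_strictMono (ω : SamplePath k) (i : Fin k) :
    StrictMono fun n : ℕ => arrival ω (i, n) :=
  strictMono_nat_of_lt_succ fun n => by
    simp only [arrival]
    rw [Finset.sum_range_succ _ (n + 1)]
    linarith [((ω.2 i).1 (n + 1)).1]

theorem exists_arrival_lt_iff (ω : SamplePath k) (i : Fin k) (t : ℝ) :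
    ∃ A : ℕ, ∀ m, arrival ω (i, m) < t ↔ m < A := by
  have hex : ∃ n, t ≤ arrival ω (i, n) := ((ω.2 i).2.eventually_ge_atTop t).exists
  classical
  refine ⟨Nat.find hex, fun m => ⟨fun h => ?_, fun h => not_le.1 (Nat.find_min hex h)⟩⟩
  by_contra hm
  exact absurd (((Nat.find_spec hex).trans
    ((arrival_strictMono ω i).monotone (not_lt.1 hm))).trans_lt h) (lt_irrefl _)

theorem timer_sum_strictMono (ω : SamplePath k) (i : Fin k) :
    StrictMono fun n : ℕ => ∑ m ∈ Finset.range (n + 1), (ω.1 i m).2 :=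
  strictMono_nat_of_lt_succ fun n => by
    rw [Finset.sum_range_succ _ (n + 1)]
    linarith [((ω.2 i).1 (n + 1)).2]

theorem timer_sum_pos (ω : SamplePath k) (i : Fin k) (n : ℕ) :
    0 < ∑ m ∈ Finset.range (n + 1), (ω.1 i m).2 :=
  Finset.sum_pos (fun m _ => ((ω.2 i).1 m).2) ⟨0, by simp⟩

/-! ### Service clocks and timer events -/

theorem workTime_mono (σ : ℝ → Option (Job k)) (i : Fin k) : Monotone (workTime σ i) :=
  fun _ _ h => measure_mono fun _ hx => ⟨⟨hx.1.1, hx.1.2.trans h⟩, hx.2⟩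

theorem workTime_of_nonpos {t : ℝ} (ht : t ≤ 0) : workTime σ i t = 0 := by
  simp [workTime, Ioc_eq_empty (not_lt.2 ht)]

/-- The clock runs at rate at most one. Only subadditivity of the measure is used, so the schedule
need not be measurable in time. -/
theorem workTime_le_add (σ : ℝ → Option (Job k)) (i : Fin k) (s t : ℝ) :
    workTime σ i t ≤ workTime σ i s + ENNReal.ofReal (t - s) := by
  rw [← Real.volume_Ioc]
  refine (measure_mono fun x hx => ?_).trans (measure_union_le _ _)
  by_cases h : x ≤ s
  · exact Or.inl ⟨⟨hx.1.1, h⟩, hx.2⟩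
  · exact Or.inr ⟨not_le.1 h, hx.1.2⟩

theorem workTime_congr (h : ∀ t, (σ t).map Prod.fst = (σ' t).map Prod.fst) :
    workTime σ = workTime σ' := by
  ext i t
  simp only [workTime, h]

theorem timerFires_congr (h : ∀ t, (σ t).map Prod.fst = (σ' t).map Prod.fst) :
    TimerFires ω σ = TimerFires ω σ' := by
  ext i n d
  simp only [TimerFires, workTime_congr h]

/-- By the Lipschitz bound on the clock, the infimum of the times at which the threshold has been
reached is itself such a time. -/
theorem exists_timerFires {n : ℕ} {t : ℝ}
    (h : ENNReal.ofReal (∑ m ∈ Finset.range (n + 1), (ω.1 i m).2) ≤ workTime σ i t) :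
    ∃ d ≤ t, TimerFires ω σ i n d := by
  set L := ∑ m ∈ Finset.range (n + 1), (ω.1 i m).2 with hL
  set S : Set ℝ := {t | ENNReal.ofReal L ≤ workTime σ i t} with hS
  have hb : BddBelow S := by
    refine ⟨0, fun x hx => ?_⟩
    by_contra h0
    have hx' : ENNReal.ofReal L ≤ workTime σ i x := hx
    rw [workTime_of_nonpos (not_le.1 h0).le, nonpos_iff_eq_zero, ENNReal.ofReal_eq_zero] at hx'
    exact absurd hx' (not_le.2 (timer_sum_pos ω i n))
  have hne : S.Nonempty := ⟨t, h⟩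
  refine ⟨sInf S, csInf_le hb h, ?_, fun x hx => csInf_le hb hx⟩
  refine ENNReal.le_of_forall_pos_le_add fun ε hε _ => ?_
  obtain ⟨x, hx, hxlt⟩ := exists_lt_of_csInf_lt hne
    (lt_add_of_pos_right (sInf S) (NNReal.coe_pos.2 hε))
  refine (show ENNReal.ofReal L ≤ workTime σ i x from hx).trans
    ((workTime_le_add σ i (sInf S) x).trans (add_le_add_right ?_ _))
  rw [← ENNReal.ofReal_coe_nnreal]
  exact ENNReal.ofReal_le_ofReal (by linarith)

/-- The clock cannot jump, so it does not overshoot the threshold: at `d - ε` the threshold is not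
yet reached. -/
theorem TimerFires.workTime_le {n : ℕ} {d : ℝ} (h : TimerFires ω σ i n d) :
    workTime σ i d ≤ ENNReal.ofReal (∑ m ∈ Finset.range (n + 1), (ω.1 i m).2) := by
  refine ENNReal.le_of_forall_pos_le_add fun ε hε _ => ?_
  have hε' : (0 : ℝ) < ε := hε
  refine (workTime_le_add σ i (d - ε) d).trans ?_
  rw [sub_sub_cancel, ENNReal.ofReal_coe_nnreal]
  refine add_le_add_left (le_of_not_ge fun hle => ?_) _
  linarith [h.2 hle]

theorem TimerFires.lt {n n' : ℕ} {d d' : ℝ} (h : TimerFires ω σ i n d)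
    (h' : TimerFires ω σ i n' d') (hn : n < n') : d < d' := by
  by_contra hd
  have hle := h'.1.trans ((workTime_mono σ i (not_lt.1 hd)).trans h.workTime_le)
  rw [ENNReal.ofReal_le_ofReal_iff (timer_sum_pos ω i n).le] at hle
  exact absurd (timer_sum_strictMono ω i hn) (not_lt.2 hle)

theorem TimerFires.exists_lt {n n' : ℕ} {d' : ℝ} (h' : TimerFires ω σ i n' d') (hn : n < n') :
    ∃ d < d', TimerFires ω σ i n d := by
  obtain ⟨d, -, hd⟩ := exists_timerFires (n := n)
    ((ENNReal.ofReal_le_ofReal (timer_sum_strictMono ω i hn).le).trans h'.1)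
  exact ⟨d, hd.lt h' hn, hd⟩

/-! ### Counting timer events and completions -/

/-- The indices of the timer settings of class `i` that have run out before time `t`. -/
def fired (ω : SamplePath k) (σ : ℝ → Option (Job k)) (i : Fin k) (t : ℝ) : Set ℕ :=
  {n | ∃ d < t, TimerFires ω σ i n d}

/-- The indices of the jobs of class `i` that have completed before time `t`. -/
def completed (ω : SamplePath k) (σ : ℝ → Option (Job k)) (i : Fin k) (t : ℝ) : Set ℕ :=
  {m | ∃ d < t, Completes ω σ (i, m) d}

theorem isLowerSet_fired : ∀ t, IsLowerSet (fired ω σ i t) := by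
  rintro t n n' hn ⟨d, hdt, hd⟩
  rcases hn.eq_or_lt with rfl | hn
  · exact ⟨d, hdt, hd⟩
  · obtain ⟨d', hd', h⟩ := hd.exists_lt hn
    exact ⟨d', hd'.trans hdt, h⟩

/-- Trades the existence of a real firing time for a countable union, as measurability of the FCFS
policy requires. -/
theorem mem_fired_iff_exists_rat {n : ℕ} {t : ℝ} : n ∈ fired ω σ i t ↔ ∃ q : ℚ, (q : ℝ) < t ∧
    ENNReal.ofReal (∑ m ∈ Finset.range (n + 1), (ω.1 i m).2) ≤ workTime σ i q := by
  constructor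
  · rintro ⟨d, hdt, hd⟩
    obtain ⟨q, hdq, hqt⟩ := exists_rat_btwn hdt
    exact ⟨q, hqt, hd.1.trans (workTime_mono σ i hdq.le)⟩
  · rintro ⟨q, hqt, hq⟩
    obtain ⟨d, hdq, hd⟩ := exists_timerFires hq
    exact ⟨d, hdq.trans_lt hqt, hd⟩

theorem present_iff_notMem_completed {m : ℕ} {t : ℝ} :
    Present ω σ (i, m) t ↔ arrival ω (i, m) < t ∧ m ∉ completed ω σ i t := by
  simp [Present, completed]

theorem eq_Iio_ncard {F : Set ℕ} (hF : IsLowerSet F) (hfin : F.Finite) : F = Iio F.ncard := by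
  obtain h | ⟨a, h⟩ := hF.eq_univ_or_Iio
  · exact absurd (h ▸ hfin) infinite_univ
  · rw [h, ncard_Iio_nat]

/-- Timer events of a class occur one at a time and in order. Both the count from `0` and the strict
inequality in `fired` matter: event `n` itself is not included. -/
theorem TimerFires.fired_eq {n : ℕ} {d : ℝ} (h : TimerFires ω σ i n d) :
    fired ω σ i d = Iio n := by
  ext m
  refine ⟨?_, fun hm => h.exists_lt hm⟩
  rintro ⟨d', hd', h'⟩
  rw [mem_Iio]
  by_contra hm
  rcases (not_lt.1 hm).eq_or_lt with rfl | hm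
  · exact hd'.ne (h'.unique h)
  · exact lt_asymm hd' (h.lt h' hm)

/-- A schedule on which only jobs in the system are served and every timer event completes a
job. -/
structure Admissible (ω : SamplePath k) (σ : ℝ → Option (Job k)) : Prop where
  present : ∀ t j, σ t = some j → Present ω σ j t
  inService : ∀ i n d, TimerFires ω σ i n d → ∃ m, σ d = some (i, m)

namespace Admissible

theorem arrival_lt_of_mem_completed (h : Admissible ω σ) {m : ℕ} {t : ℝ}
    (hm : m ∈ completed ω σ i t) : arrival ω (i, m) < t := by
  obtain ⟨d, hdt, hd, -⟩ := hm
  exact (h.present d _ hd).1.trans hdt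

theorem finite_completed (h : Admissible ω σ) (i : Fin k) (t : ℝ) :
    (completed ω σ i t).Finite := by
  obtain ⟨A, hA⟩ := exists_arrival_lt_iff ω i t
  exact (finite_Iio A).subset fun m hm => (hA m).1 (h.arrival_lt_of_mem_completed hm)

/-- Send each timer event to the job in service at that moment. Two events cannot hit the same job,
since after the first one it is no longer in the system. -/
theorem exists_bijOn (h : Admissible ω σ) (i : Fin k) (t : ℝ) :
    ∃ f : ℕ → ℕ, BijOn f (fired ω σ i t) (completed ω σ i t) := by
  have hex : ∀ n, ∃ m, n ∈ fired ω σ i t →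
      ∃ d < t, TimerFires ω σ i n d ∧ σ d = some (i, m) := by
    intro n
    by_cases hn : n ∈ fired ω σ i t
    · obtain ⟨d, hdt, hd⟩ := hn
      obtain ⟨m, hm⟩ := h.inService i n d hd
      exact ⟨m, fun _ => ⟨d, hdt, hd, hm⟩⟩
    · exact ⟨0, fun h => absurd h hn⟩
  choose f hf using hex
  have hlt : ∀ n ∈ fired ω σ i t, ∀ n' ∈ fired ω σ i t, f n = f n' → ¬ n < n' := by
    intro n hn n' hn' he hlt
    obtain ⟨d, -, hd, hm⟩ := hf n hn
    obtain ⟨d', -, hd', hm'⟩ := hf n' hn'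
    rw [← he] at hm'
    exact (h.present d' _ hm').2 d (hd.lt hd' hlt) ⟨hm, n, hd⟩
  refine ⟨f, fun n hn => ?_, fun n hn n' hn' he => ?_, ?_⟩
  · obtain ⟨d, hdt, hd, hm⟩ := hf n hn
    exact ⟨d, hdt, hm, n, hd⟩
  · exact le_antisymm (not_lt.1 (hlt n' hn' n hn he.symm)) (not_lt.1 (hlt n hn n' hn' he))
  · rintro m ⟨d, hdt, hm, n, hd⟩
    have hn : n ∈ fired ω σ i t := ⟨d, hdt, hd⟩
    refine ⟨n, hn, ?_⟩
    obtain ⟨d', -, hd', hm'⟩ := hf n hn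
    rw [hd'.unique hd, hm] at hm'
    simpa using hm'.symm

/-- Regularity does not force the timer sums to diverge; finiteness comes instead from the finitely
many arrivals, each completing at most once. -/
theorem finite_fired (h : Admissible ω σ) (i : Fin k) (t : ℝ) : (fired ω σ i t).Finite := by
  obtain ⟨f, hf⟩ := h.exists_bijOn i t
  exact Finite.of_finite_image (hf.image_eq ▸ h.finite_completed i t) hf.injOn

theorem ncard_completed (h : Admissible ω σ) (i : Fin k) (t : ℝ) :
    (completed ω σ i t).ncard = (fired ω σ i t).ncard := by
  obtain ⟨f, hf⟩ := h.exists_bijOn i t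
  rw [← hf.image_eq, hf.injOn.ncard_image]

theorem fired_eq (h : Admissible ω σ) (i : Fin k) (t : ℝ) :
    fired ω σ i t = Iio (fired ω σ i t).ncard :=
  eq_Iio_ncard (isLowerSet_fired t) (h.finite_fired i t)

/-- While class `i` is being served, strictly more jobs of the class have arrived than have
completed. -/
theorem arrival_ncard_fired_lt (h : Admissible ω σ) {t : ℝ} {m : ℕ} (hm : σ t = some (i, m)) :
    arrival ω (i, (fired ω σ i t).ncard) < t := by
  obtain ⟨A, hA⟩ := exists_arrival_lt_iff ω i t
  obtain ⟨hmA, hmC⟩ := present_iff_notMem_completed.1 (h.present t _ hm)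
  -- The completed jobs together with `m`, which is still present, are one more than the timer
  -- events, and all lie among the `A` arrived jobs.
  rw [hA, ← h.ncard_completed i t, Nat.lt_iff_add_one_le,
    ← ncard_insert_of_notMem hmC (h.finite_completed i t), ← ncard_Iio_nat A]
  refine ncard_le_ncard (insert_subset ((hA m).1 hmA) fun n hn => ?_) (finite_Iio A)
  exact (hA n).1 (h.arrival_lt_of_mem_completed hn)

/-- If each class is served in order of arrival, then the completed jobs are the first ones. -/
theorem completed_eq_of_fcfs (h : Admissible ω σ)
    (hf : ∀ t i n, σ t = some (i, n) → ∀ m < n, ¬ Present ω σ (i, m) t) (i : Fin k) (t : ℝ) :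
    completed ω σ i t = Iio (fired ω σ i t).ncard := by
  rw [← h.ncard_completed i t]
  refine eq_Iio_ncard ?_ (h.finite_completed i t)
  rintro n m hmn ⟨d, hdt, hd⟩
  rcases hmn.eq_or_lt with rfl | hmn
  · exact ⟨d, hdt, hd⟩
  -- When `n` completes, FCFS keeps the earlier job `m` out of the system; as `m` has already
  -- arrived, it must have completed.
  have hnp := hf d i n hd.1 m hmn
  rw [present_iff_notMem_completed, not_and, not_not] at hnp
  obtain ⟨d', hd', hc⟩ := hnp
    (((arrival_strictMono ω i) hmn).trans (h.present d _ hd.1).1)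
  exact ⟨d', hd'.trans hdt, hc⟩

end Admissible

/-! ### Comparison of holding costs -/

/-- An exchange argument: the two index sets have equal size, and outside their intersection the
terms on the left are at most `g N` and those on the right at least `g N`. -/
theorem sum_Ico_le_sum_range_sdiff {A : ℕ} {C : Finset ℕ} (hC : C ⊆ Finset.range A) {g : ℕ → ℝ≥0∞}
    (hg : AntitoneOn g (Iio A)) :
    ∑ m ∈ Finset.Ico C.card A, g m ≤ ∑ m ∈ Finset.range A \ C, g m := by
  set N := C.card
  set T := Finset.Ico N A with hT
  set S := Finset.range A \ C with hS
  have hNA : N ≤ A := by simpa using Finset.card_le_card hC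
  have hcard : (T \ S).card = (S \ T).card := by
    refine Finset.card_sdiff_comm ?_
    rw [hT, hS, Nat.card_Ico, Finset.card_sdiff_of_subset hC, Finset.card_range]
  rw [← Finset.sum_inter_add_sum_sdiff T S, ← Finset.sum_inter_add_sum_sdiff S T, Finset.inter_comm]
  refine add_le_add_right ?_ _
  calc ∑ m ∈ T \ S, g m ≤ (T \ S).card • g N := by
        refine Finset.sum_le_card_nsmul _ _ _ fun m hm => ?_
        obtain ⟨h1, h2⟩ := Finset.mem_Ico.1 (Finset.mem_sdiff.1 hm).1
        exact hg (h1.trans_lt h2) h2 h1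
    _ = (S \ T).card • g N := by rw [hcard]
    _ ≤ ∑ m ∈ S \ T, g m := by
        refine Finset.card_nsmul_le_sum _ _ _ fun m hm => ?_
        obtain ⟨h1, h2⟩ := Finset.mem_sdiff.1 hm
        have hmA : m < A := Finset.mem_range.1 (Finset.mem_sdiff.1 h1).1
        have hmN : m < N := by
          by_contra h
          exact h2 (Finset.mem_Ico.2 ⟨not_lt.1 h, hmA⟩)
        -- If `N = A`, then `N` lies outside the set where `g` is antitone, but in that case `S` is
        -- empty.
        rcases hNA.eq_or_lt with h | h
        · have : C = Finset.range A := Finset.eq_of_subset_of_card_le hC (by simp [← h, N])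
          simp [hS, this] at h1
        · exact hg hmA h hmN.le

theorem totalCost_eq (c : Fin k → ℝ → ℝ) (ω : SamplePath k) (σ : ℝ → Option (Job k)) (s : ℝ) :
    totalCost c ω σ s = ∑' (i : Fin k) (m : ℕ), {m | Present ω σ (i, m) s}.indicator
      (fun m => ENNReal.ofReal (c i (s - arrival ω (i, m)))) m := by
  rw [totalCost, ← ENNReal.tsum_prod]
  exact tsum_subtype {j : Job k | Present ω σ j s}
    (fun j => ENNReal.ofReal (c j.1 (s - arrival ω j)))

theorem Admissible.tsum_indicator_present (h : Admissible ω σ) {s : ℝ} {A : ℕ}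
    (hA : ∀ m, arrival ω (i, m) < s ↔ m < A) (g : ℕ → ℝ≥0∞) :
    ∑' m, {m | Present ω σ (i, m) s}.indicator g m =
      ∑ m ∈ Finset.range A \ (h.finite_completed i s).toFinset, g m := by
  rw [← tsum_subtype, ← Finset.tsum_subtype]
  have : {m | Present ω σ (i, m) s} =
      {m | m ∈ Finset.range A \ (h.finite_completed i s).toFinset} := by
    ext m
    simp [present_iff_notMem_completed, hA]
  exact tsum_congr_set_coe _ this

/-- At every moment serving each class in order of arrival minimizes the total holding cost. -/
theorem totalCost_le_of_fcfs {c : Fin k → ℝ → ℝ} (hc : ∀ i, MonotoneOn (c i) (Ici 0))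
    (h : Admissible ω σ) (h' : Admissible ω σ')
    (hf : ∀ t i n, σ' t = some (i, n) → ∀ m < n, ¬ Present ω σ' (i, m) t)
    (hs : ∀ t, (σ t).map Prod.fst = (σ' t).map Prod.fst) (s : ℝ) :
    totalCost c ω σ' s ≤ totalCost c ω σ s := by
  rw [totalCost_eq, totalCost_eq]
  refine ENNReal.tsum_le_tsum fun i => ?_
  obtain ⟨A, hA⟩ := exists_arrival_lt_iff ω i s
  rw [h.tsum_indicator_present hA, h'.tsum_indicator_present hA]
  -- Working on the same class enters here: the completions of `σ` are counted by the timer events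
  -- of `σ'`.
  have hcard : (h.finite_completed i s).toFinset.card = (fired ω σ' i s).ncard := by
    rw [← ncard_eq_toFinset_card _ (h.finite_completed i s), h.ncard_completed]
    simp only [fired, timerFires_congr hs]
  have hIco : Finset.range A \ (h'.finite_completed i s).toFinset =
      Finset.Ico (h.finite_completed i s).toFinset.card A := by
    ext m
    rw [hcard]
    simp [h'.completed_eq_of_fcfs hf, and_comm]
  rw [hIco]
  refine sum_Ico_le_sum_range_sdiff (fun m hm => ?_) fun m hm n hn hmn => ?_
  · rw [Finite.mem_toFinset] at hm
    exact Finset.mem_range.2 ((hA m).1 (h.arrival_lt_of_mem_completed hm))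
  -- A larger index means a later arrival, hence a smaller age; both ages are nonnegative, where `c
  -- i` is monotone.
  · have h1 := (arrival_strictMono ω i).monotone hmn
    have h2 := (hA n).2 hn
    have h3 := (hA m).2 hm
    beta_reduce at h1
    exact ENNReal.ofReal_le_ofReal (hc i (mem_Ici.2 (by linarith)) (mem_Ici.2 (by linarith))
      (by linarith))

end Schedules

section Policies

variable {k : ℕ} {U : Type*} {π π' : U → SamplePath k → ℝ → Option (Job k)}

/-! ### The FCFS policy -/

/-- The policy that serves the same class as `π`, and within the class the job whose index is the
number of timer events of the class so far. -/
noncomputable def fcfsPolicy (π : U → SamplePath k → ℝ → Option (Job k)) :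
    U → SamplePath k → ℝ → Option (Job k) :=
  fun u ω t => (π u ω t).map fun j => (j.1, (fired ω (π u ω) j.1 t).ncard)

theorem sameClass_fcfsPolicy (π : U → SamplePath k → ℝ → Option (Job k)) :
    SameClass π (fcfsPolicy π) := by
  intro u ω t
  simp [fcfsPolicy, Function.comp_def]

theorem fcfsPolicy_eq_some_iff {u : U} {ω : SamplePath k} {t : ℝ} {i : Fin k} {n : ℕ} :
    fcfsPolicy π u ω t = some (i, n) ↔
      (∃ m, π u ω t = some (i, m)) ∧ (fired ω (π u ω) i t).ncard = n := by
  simp only [fcfsPolicy, Option.map_eq_some_iff, Prod.mk.injEq, Prod.exists]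
  constructor
  · rintro ⟨i', m, hm, rfl, rfl⟩
    exact ⟨⟨m, hm⟩, rfl⟩
  · rintro ⟨⟨m, hm⟩, rfl⟩
    exact ⟨i, m, hm, rfl, rfl⟩

theorem timerFires_fcfsPolicy (π : U → SamplePath k → ℝ → Option (Job k)) (u : U)
    (ω ω' : SamplePath k) : TimerFires ω' (fcfsPolicy π u ω) = TimerFires ω' (π u ω) :=
  (timerFires_congr (sameClass_fcfsPolicy π u ω)).symm

variable [MeasurableSpace U]

theorem IsPolicy.admissible (h : IsPolicy π) (u : U) (ω : SamplePath k) :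
    Admissible ω (π u ω) :=
  ⟨h.present u ω, h.inService u ω⟩

/-- At the `n`-th timer event exactly `n` events precede it, so the job then in service is job `n`.
-/
theorem IsPolicy.completes_fcfsPolicy_iff (h : IsPolicy π) {u : U} {ω : SamplePath k} {i : Fin k}
    {n : ℕ} {d : ℝ} :
    Completes ω (fcfsPolicy π u ω) (i, n) d ↔ TimerFires ω (π u ω) i n d := by
  simp only [Completes, timerFires_fcfsPolicy, fcfsPolicy_eq_some_iff]
  constructor
  · rintro ⟨⟨-, hn⟩, n', hn'⟩
    rw [hn'.fired_eq, ncard_Iio_nat] at hn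
    exact hn ▸ hn'
  · intro hn
    exact ⟨⟨h.inService u ω i n d hn, by rw [hn.fired_eq, ncard_Iio_nat]⟩, n, hn⟩

theorem IsPolicy.present_fcfsPolicy_iff (h : IsPolicy π) {u : U} {ω : SamplePath k} {i : Fin k}
    {n : ℕ} {t : ℝ} : Present ω (fcfsPolicy π u ω) (i, n) t ↔
      arrival ω (i, n) < t ∧ (fired ω (π u ω) i t).ncard ≤ n := by
  rw [present_iff_notMem_completed]
  have : completed ω (fcfsPolicy π u ω) i t = Iio (fired ω (π u ω) i t).ncard := by
    rw [← (h.admissible u ω).fired_eq]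
    simp only [completed, fired, h.completes_fcfsPolicy_iff]
  rw [this, mem_Iio, not_lt]

theorem IsPolicy.servesFCFS_fcfsPolicy (h : IsPolicy π) : ServesFCFS (fcfsPolicy π) := by
  intro u ω t i n hn m hmn hp
  rw [h.present_fcfsPolicy_iff, (fcfsPolicy_eq_some_iff.1 hn).2] at hp
  exact absurd hmn (not_lt.2 hp.2)

theorem IsPolicy.measurableSet_class (h : IsPolicy π) (i : Fin k) :
    MeasurableSet {p : U × SamplePath k × ℝ | ∃ m, π p.1 p.2.1 p.2.2 = some (i, m)} := by
  have : {p : U × SamplePath k × ℝ | ∃ m, π p.1 p.2.1 p.2.2 = some (i, m)} =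
      ⋃ m, {p : U × SamplePath k × ℝ | π p.1 p.2.1 p.2.2 = some (i, m)} := by
    ext p; simp
  rw [this]
  exact MeasurableSet.iUnion fun m => h.measurable (i, m)

/-- The clock is the measure of the time sections of a jointly measurable set. -/
theorem IsPolicy.measurable_workTime (h : IsPolicy π) (i : Fin k) (t : ℝ) :
    Measurable fun p : U × SamplePath k => workTime (π p.1 p.2) i t := by
  have hS : MeasurableSet {p : (U × SamplePath k) × ℝ |
      p.2 ∈ Ioc 0 t ∧ ∃ m, π p.1.1 p.1.2 p.2 = some (i, m)} :=
    (measurableSet_Ioc.preimage measurable_snd).inter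
      ((h.measurableSet_class i).preimage MeasurableEquiv.prodAssoc.measurable)
  convert measurable_measure_prodMk_left (ν := (volume : Measure ℝ)) hS using 2 with p
  simp only [workTime]
  congr 1
  ext s
  simp [Option.map_eq_some_iff]

theorem IsPolicy.measurableSet_fired (h : IsPolicy π) (i : Fin k) (n : ℕ) :
    MeasurableSet {p : U × SamplePath k × ℝ | n ∈ fired p.2.1 (π p.1 p.2.1) i p.2.2} := by
  simp only [mem_fired_iff_exists_rat]
  have : {p : U × SamplePath k × ℝ | ∃ q : ℚ, (q : ℝ) < p.2.2 ∧
      ENNReal.ofReal (∑ m ∈ Finset.range (n + 1), (p.2.1.1 i m).2) ≤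
        workTime (π p.1 p.2.1) i q} =
      ⋃ q : ℚ, {p : U × SamplePath k × ℝ | (q : ℝ) < p.2.2} ∩ {p |
      ENNReal.ofReal (∑ m ∈ Finset.range (n + 1), (p.2.1.1 i m).2) ≤
        workTime (π p.1 p.2.1) i q} := by
    ext p; simp
  rw [this]
  refine MeasurableSet.iUnion fun q => (measurableSet_lt measurable_const (by fun_prop)).inter
    (measurableSet_le ?_ ?_)
  · have : Measurable fun p : U × SamplePath k × ℝ => p.2.1.1 :=
      measurable_subtype_coe.comp (measurable_fst.comp measurable_snd)
    exact (Finset.measurable_fun_sum _ fun m _ => (measurable_pi_apply m).snd.comp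
      ((measurable_pi_apply i).comp this)).ennreal_ofReal
  · exact (h.measurable_workTime i q).comp
      (measurable_fst.prodMk (measurable_fst.comp measurable_snd))

theorem IsPolicy.measurableSet_ncard_fired (h : IsPolicy π) (i : Fin k) (n : ℕ) :
    MeasurableSet {p : U × SamplePath k × ℝ |
      (fired p.2.1 (π p.1 p.2.1) i p.2.2).ncard = n} := by
  have : {p : U × SamplePath k × ℝ | (fired p.2.1 (π p.1 p.2.1) i p.2.2).ncard = n} =
      ⋂ m, {p : U × SamplePath k × ℝ | m ∈ fired p.2.1 (π p.1 p.2.1) i p.2.2 ↔ m < n} := by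
    ext p
    simp only [mem_iInter, mem_ofPred_eq]
    constructor
    · intro hn m
      -- Finiteness of `fired`, contained in `fired_eq`, excludes the default value `0` of `ncard`
      -- on infinite sets.
      rw [(h.admissible p.1 p.2.1).fired_eq, hn, mem_Iio]
    · intro hn
      have : fired p.2.1 (π p.1 p.2.1) i p.2.2 = Iio n := by ext m; exact hn m
      rw [this, ncard_Iio_nat]
  rw [this]
  exact MeasurableSet.iInter fun m => (h.measurableSet_fired i m).iff (MeasurableSet.const _)

theorem IsPolicy.isPolicy_fcfsPolicy (h : IsPolicy π) : IsPolicy (fcfsPolicy π) where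
  measurable := by
    rintro ⟨i, n⟩
    simp only [fcfsPolicy_eq_some_iff]
    exact (h.measurableSet_class i).inter (h.measurableSet_ncard_fired i n)
  present := by
    rintro u ω t ⟨i, n⟩ hn
    obtain ⟨⟨m, hm⟩, rfl⟩ := fcfsPolicy_eq_some_iff.1 hn
    exact h.present_fcfsPolicy_iff.2 ⟨(h.admissible u ω).arrival_ncard_fired_lt hm, le_rfl⟩
  inService := by
    intro u ω i n d hd
    rw [timerFires_fcfsPolicy] at hd
    exact ⟨n, (h.completes_fcfsPolicy_iff.2 hd).1⟩
  nonanticipating := by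
    intro u ω ω' t ha hT
    simp only [timerFires_fcfsPolicy] at hT
    -- The timer events are those of `π`, so agreement before `t` fixes both the class that `π`
    -- picks and the count that selects the job.
    have hfired : ∀ i, fired ω (π u ω) i t = fired ω' (π u ω') i t := by
      intro i
      ext n
      exact exists_congr fun d => and_congr_right fun hd => hT i n d hd
    simp only [fcfsPolicy, h.nonanticipating u ω ω' t ha hT, hfired]

/-! ### Passage to integrated and long-run costs -/

theorem costUpTo_le_of_servesFCFS {c : Fin k → ℝ → ℝ} (hc : ∀ i, MonotoneOn (c i) (Ici 0))
    (h : IsPolicy π) (h' : IsPolicy π') (hf : ServesFCFS π') (hs : SameClass π π') (u : U)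
    (ω : SamplePath k) (t : ℝ) : costUpTo c ω (π' u ω) t ≤ costUpTo c ω (π u ω) t :=
  lintegral_mono fun s => totalCost_le_of_fcfs hc (h.admissible u ω) (h'.admissible u ω)
    (hf u ω) (hs u ω) s

theorem pathCost_mono {c : Fin k → ℝ → ℝ} {ω : SamplePath k} {σ σ' : ℝ → Option (Job k)}
    (h : ∀ t, costUpTo c ω σ' t ≤ costUpTo c ω σ t) : pathCost c ω σ' ≤ pathCost c ω σ :=
  limsup_le_limsup (Eventually.of_forall fun t => ENNReal.div_le_div_right (h t) _)

theorem meanCost_mono (ν : Measure U) (lam mu : Fin k → ℝ) {c : Fin k → ℝ → ℝ}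
    (h : ∀ u ω t, costUpTo c ω (π' u ω) t ≤ costUpTo c ω (π u ω) t) :
    meanCost ν lam mu c π' ≤ meanCost ν lam mu c π :=
  limsup_le_limsup (Eventually.of_forall fun t => ENNReal.div_le_div_right
    (lintegral_mono fun u => lintegral_mono fun ω => h u ω t) _)

end Policies

end TVHC

theorem mainTheorem5 {k : ℕ} {U : Type*} [MeasurableSpace U] (ν : Measure U)
    [IsProbabilityMeasure ν] (lam mu : Fin k → ℝ) (hlam : ∀ i, 0 < lam i) (hmu : ∀ i, 0 < mu i)
    (c : Fin k → ℝ → ℝ) (hc_mono : ∀ i, MonotoneOn (c i) (Ici 0))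
    (hc_nonneg : ∀ i, ∀ t, 0 ≤ t → 0 ≤ c i t)
    (π : U → TVHC.SamplePath k → ℝ → Option (TVHC.Job k)) (hπ : TVHC.IsPolicy π) :
    (∃ π' : U → TVHC.SamplePath k → ℝ → Option (TVHC.Job k),
      TVHC.IsPolicy π' ∧ TVHC.ServesFCFS π' ∧ TVHC.SameClass π π') ∧
    ∀ π' : U → TVHC.SamplePath k → ℝ → Option (TVHC.Job k),
      TVHC.IsPolicy π' → TVHC.ServesFCFS π' → TVHC.SameClass π π' →
        (∀ u ω t, TVHC.costUpTo c ω (π' u ω) t ≤ TVHC.costUpTo c ω (π u ω) t) ∧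
        (∀ u ω, TVHC.pathCost c ω (π' u ω) ≤ TVHC.pathCost c ω (π u ω)) ∧
        TVHC.meanCost ν lam mu c π' ≤ TVHC.meanCost ν lam mu c π ∧
        (TVHC.IsPathOptimal ν lam mu c π → TVHC.IsPathOptimal ν lam mu c π') ∧
        (TVHC.IsMeanOptimal ν lam mu c π → TVHC.IsMeanOptimal ν lam mu c π') := by

  refine ⟨⟨TVHC.fcfsPolicy π, hπ.isPolicy_fcfsPolicy, hπ.servesFCFS_fcfsPolicy,
    TVHC.sameClass_fcfsPolicy π⟩, fun π' hπ' hf hs => ?_⟩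
  have hcost := TVHC.costUpTo_le_of_servesFCFS hc_mono hπ hπ' hf hs
  have hpath : ∀ u ω, TVHC.pathCost c ω (π' u ω) ≤ TVHC.pathCost c ω (π u ω) :=
    fun u ω => TVHC.pathCost_mono (hcost u ω)
  have hmean := TVHC.meanCost_mono ν lam mu hcost
  refine ⟨hcost, hpath, hmean, fun h => ⟨hπ', fun π₂ h₂ => ?_⟩,
    fun h => ⟨hπ', fun π₂ h₂ => hmean.trans (h.2 π₂ h₂)⟩⟩
  filter_upwards [h.2 π₂ h₂] with p hp
  exact (hpath p.1 p.2).trans hp
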